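/- Let $\Omega\subset\mathbb R^2$ be a bounded Lipschitz domain whose boundary is a disjoint union $\partial\Omega=\Gamma_{\mathrm D}\mathbin{\dot\cup}\Gamma_{\mathrm N}$ of sets measurable with respect to arc length, where $\Gamma_{\mathrm D}$ has positive arc length measure. Let $\alpha>1$, $1/\alpha+1/\alpha'=1$, $\kappa>0$, $\tau_0\ge 0$ and $f\in L^{\alpha'}(\Omega)$. Write $|\cdot|$ for the Euclidean norm, $(\cdot,\cdot)_\alpha$ for the integral pairings of $L^{\alpha'}(\Omega)$ with $L^\alpha(\Omega)$ and of $L^{\alpha'}(\Omega;\mathbb R^2)$ with $L^\alpha(\Omega;\mathbb R^2)$, and $Y=\{y\in W^{1,\alpha}(\Omega): y|_{\Gamma_{\mathrm D}}=0\}$, the boundary values being taken in the sense of traces. For $y\in Y$, $q\in L^\alpha(\Omega;\mathbb R^2)$ and $\tau\in L^{\alpha'}(\Omega;\mathbb R^2)$ set $$\tilde I(y,q)=\frac{\kappa}{\alpha}\int_\Omega|q|^\alpha\,dx+\tau_0\int_\Omega|q|\,dx-(f,y)_\alpha,\qquad L(y,q,\tau)=\tilde I(y,q)-(\tau,q-\nabla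 y)_\alpha .$$ Let $(y^*,q^*)\in Y\times L^\alpha(\Omega;\mathbb R^2)$ minimise $\tilde I(y,q)$ over all $(y,q)\in Y\times L^\alpha(\Omega;\mathbb R^2)$ with $q-\nabla y=0$. Then there is a Lagrange multiplier $\tau^*\in L^{\alpha'}(\Omega;\mathbb R^2)$ with the following properties. 1. The KKT conditions hold: $$D_yL(y^*,q^*,\tau^*)=0,\qquad 0\in\partial_qL(y^*,q^*,\tau^*),\qquad D_\tau L(y^*,q^*,\tau^*)=0,$$ where $D_y,D_\tau$ are the partial Fréchet derivatives and $\partial_q$ is the convex subdifferential with respect to $q$. Written out, $$(\tau^*,\nabla z)_\alpha=(f,z)_\alpha\quad\text{for all } z\in Y,$$ $$\left(\kappa|q^*|^{\alpha-2}q^*-\tau^*,\,r-q^*\right)_\alpha+\tau_0\int_\Omega|r|\,dx-\tau_0\int_\Omega|q^*|\,dx\ge0\quad\text{for all } r\in L^\alpha(\Omega;\mathbb R^2),$$ $$q^*=\nabla y^*\quad\text{a.e. in }\Omega$$ (with $|q^*|^{\alpha-2}q^*:=0$ where $q^*=0$). 2. Strong duality holds: with the extended-real-valued functions $L_{\mathrm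 p}(y,q)=\sup_{\tau\in L^{\alpha'}(\Omega;\mathbb R^2)}L(y,q,\tau)$ and $L_{\mathrm d}(\tau)=\inf_{(y,q)\in Y\times L^\alpha(\Omega;\mathbb R^2)}L(y,q,\tau)$, the pair $(y^*,q^*)$ minimises $L_{\mathrm p}$ over $Y\times L^\alpha(\Omega;\mathbb R^2)$, $\tau^*$ maximises $L_{\mathrm d}$ over $L^{\alpha'}(\Omega;\mathbb R^2)$, and $$\min_{(y,q)}L_{\mathrm p}(y,q)=L_{\mathrm p}(y^*,q^*)=L_{\mathrm d}(\tau^*)=\max_{\tau}L_{\mathrm d}(\tau).$$ -/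

import Mathlib

open MeasureTheory Filter Topology
open scoped ContDiff ENNReal

noncomputable section

namespace HerschelBulkley

/-- The Euclidean plane. -/
abbrev Plane : Type := EuclideanSpace ℝ (Fin 2)

/-! ### Exponents -/

/-- The real exponent `α` as an extended nonnegative real. -/
abbrev ex (α : ℝ) : ℝ≥0∞ := ENNReal.ofReal α

/-- The dual exponent `α' = α / (α - 1)`. -/
abbrev ex' (α : ℝ) : ℝ≥0∞ := ENNReal.ofReal α.conjExponent

instance fact_one_le_ex (α : ℝ) [h : Fact (1 < α)] : Fact (1 ≤ ex α) :=
  ⟨ENNReal.one_le_ofReal.2 h.out.le⟩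

instance fact_one_le_ex' (α : ℝ) [h : Fact (1 < α)] : Fact (1 ≤ ex' α) :=
  ⟨ENNReal.one_le_ofReal.2 (Real.HolderConjugate.conjExponent h.out).symm.lt.le⟩

instance holderConjugate_ex (α : ℝ) [h : Fact (1 < α)] :
    ENNReal.HolderConjugate (ex α) (ex' α) :=
  (Real.HolderConjugate.conjExponent h.out).ennrealOfReal

/-! ### Domain and boundary -/

/-- A bounded Lipschitz domain in the plane: a bounded, nonempty, connected open set which near
each of its boundary points is, in suitably rotated Cartesian coordinates, the part of the plane
above the graph of a Lipschitz function. -/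
structure IsLipschitzDomain (Ω : Set Plane) : Prop where
  isOpen : IsOpen Ω
  isConnected : IsConnected Ω
  isBounded : Bornology.IsBounded Ω
  locally_epigraph : ∀ x ∈ frontier Ω, ∃ (e : Plane ≃ₗᵢ[ℝ] Plane) (K : NNReal) (γ : ℝ → ℝ) (r : ℝ),
    LipschitzWith K γ ∧ 0 < r ∧
      ∀ z ∈ Metric.ball x r, z ∈ Ω ↔ γ ((e z) 0) < (e z) 1

/-- The arc length measure on the boundary of `Ω`. -/
def bdryMeasure (Ω : Set Plane) : Measure Plane :=
  (Measure.hausdorffMeasure 1).restrict (frontier Ω)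

/-! ### Function spaces -/

/-- The scalar Lebesgue space `L^p(Ω)`. -/
abbrev LpS (Ω : Set Plane) (p : ℝ≥0∞) : Type := Lp ℝ p (volume.restrict Ω)

/-- The Lebesgue space `L^p(Ω; ℝ²)` of vector fields. -/
abbrev LpV (Ω : Set Plane) (p : ℝ≥0∞) : Type := Lp Plane p (volume.restrict Ω)

/-- `g` is the weak gradient of `u` in `Ω`. -/
def HasWeakGradient (Ω : Set Plane) (u : Plane → ℝ) (g : Plane → Plane) : Prop :=
  ∀ φ : Plane → ℝ, ContDiff ℝ ∞ φ → HasCompactSupport φ → tsupport φ ⊆ Ω →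
    ∫ x in Ω, u x • gradient φ x = - ∫ x in Ω, φ x • g x

theorem continuous_gradient {φ : Plane → ℝ} (h : ContDiff ℝ ∞ φ) : Continuous (gradient φ) :=
  (InnerProductSpace.toDual ℝ Plane).symm.continuous.comp (h.continuous_fderiv (by simp))

theorem gradient_add' {φ ψ : Plane → ℝ} (hφ : ContDiff ℝ ∞ φ) (hψ : ContDiff ℝ ∞ ψ) :
    gradient (φ + ψ) = gradient φ + gradient ψ := by
  ext1 x
  simp only [gradient, Pi.add_apply]
  rw [fderiv_add (hφ.differentiable (by simp) x) (hψ.differentiable (by simp) x), map_add]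

theorem gradient_smul' {φ : Plane → ℝ} (hφ : ContDiff ℝ ∞ φ) (c : ℝ) :
    gradient (c • φ) = c • gradient φ := by
  ext1 x
  simp only [gradient, Pi.smul_apply]
  rw [fderiv_const_smul (hφ.differentiable (by simp) x), map_smul]

theorem integrable_smul_gradient {Ω : Set Plane} {α : ℝ} [Fact (1 < α)] (u : LpS Ω (ex α))
    {φ : Plane → ℝ} (h : ContDiff ℝ ∞ φ) (hc : HasCompactSupport φ) :
    Integrable (fun x => u x • gradient φ x) (volume.restrict Ω) := by
  have h1 : MemLp (gradient φ) (ex' α) (volume.restrict Ω) := by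
    refine (continuous_gradient h).memLp_of_hasCompactSupport ?_
    exact (hc.fderiv (𝕜 := ℝ)).comp_left (g := (InnerProductSpace.toDual ℝ Plane).symm) (by simp)
  exact memLp_one_iff_integrable.1 (h1.smul (Lp.memLp u))

theorem integrable_test_smul {Ω : Set Plane} {α : ℝ} [Fact (1 < α)] (g : LpV Ω (ex α))
    {φ : Plane → ℝ} (h : ContDiff ℝ ∞ φ) (hc : HasCompactSupport φ) :
    Integrable (fun x => φ x • g x) (volume.restrict Ω) := by
  have h1 : MemLp φ (ex' α) (volume.restrict Ω) := h.continuous.memLp_of_hasCompactSupport hc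
  exact memLp_one_iff_integrable.1 ((Lp.memLp g).smul h1)

/-- The Sobolev space `W^{1,α}(Ω)`, realised as the space of all pairs `(u, ∇u)` with
`u ∈ L^α(Ω)` and weak gradient `∇u ∈ L^α(Ω; ℝ²)`, with the norm
`(‖u‖_α ^ α + ‖∇u‖_α ^ α) ^ (1 / α)`. -/
def W1 (Ω : Set Plane) (α : ℝ) [Fact (1 < α)] :
    Submodule ℝ (WithLp (ex α) (LpS Ω (ex α) × LpV Ω (ex α))) where
  carrier := {w | HasWeakGradient Ω w.fst w.snd}
  zero_mem' := by
    intro φ _ _ _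
    have h1 : ∫ x in Ω, ((0 : LpS Ω (ex α)) : Plane → ℝ) x • gradient φ x = 0 := by
      refine integral_eq_zero_of_ae ?_
      filter_upwards [Lp.coeFn_zero ℝ (ex α) (volume.restrict Ω)] with x hx
      rw [hx]
      simp
    have h2 : ∫ x in Ω, φ x • ((0 : LpV Ω (ex α)) : Plane → Plane) x = 0 := by
      refine integral_eq_zero_of_ae ?_
      filter_upwards [Lp.coeFn_zero Plane (ex α) (volume.restrict Ω)] with x hx
      rw [hx]
      simp
    exact h1.trans (by rw [← neg_zero, ← h2]; rfl)
  add_mem' := by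
    intro v w hv hw φ h hc hs
    have h1 : ∫ x in Ω, (v + w).fst x • gradient φ x
        = ∫ x in Ω, (v.fst x • gradient φ x + w.fst x • gradient φ x) := by
      refine integral_congr_ae ?_
      filter_upwards [Lp.coeFn_add v.fst w.fst] with x hx
      rw [WithLp.add_fst, hx, Pi.add_apply, add_smul]
    have h2 : ∫ x in Ω, φ x • (v + w).snd x
        = ∫ x in Ω, (φ x • v.snd x + φ x • w.snd x) := by
      refine integral_congr_ae ?_
      filter_upwards [Lp.coeFn_add v.snd w.snd] with x hx
      rw [WithLp.add_snd, hx, Pi.add_apply, smul_add]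
    rw [h1, h2, integral_add (integrable_smul_gradient _ h hc) (integrable_smul_gradient _ h hc),
      integral_add (integrable_test_smul _ h hc) (integrable_test_smul _ h hc),
      hv φ h hc hs, hw φ h hc hs, neg_add]
  smul_mem' := by
    intro c v hv φ h hc hs
    have h1 : ∫ x in Ω, (c • v).fst x • gradient φ x
        = ∫ x in Ω, c • (v.fst x • gradient φ x) := by
      refine integral_congr_ae ?_
      filter_upwards [Lp.coeFn_smul c v.fst] with x hx
      rw [WithLp.smul_fst, hx, Pi.smul_apply, smul_assoc]
    have h2 : ∫ x in Ω, φ x • (c • v).snd x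
        = ∫ x in Ω, c • (φ x • v.snd x) := by
      refine integral_congr_ae ?_
      filter_upwards [Lp.coeFn_smul c v.snd] with x hx
      rw [WithLp.smul_snd, hx, Pi.smul_apply, smul_comm]
    rw [h1, h2, integral_smul, integral_smul, hv φ h hc hs, smul_neg]

/-- `g ∈ L^α(∂Ω)` is the boundary trace of `w ∈ W^{1,α}(Ω)`: there are smooth functions on the
plane whose restrictions to `Ω` converge to `w` in `W^{1,α}(Ω)` and whose restrictions to `∂Ω`
converge to `g` in `L^α(∂Ω)`.  In other words, `g` is the image of `w` under the continuous
extension to `W^{1,α}(Ω)` of the restriction map `φ ↦ φ|_{∂Ω}`. -/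
def HasTrace {Ω : Set Plane} {α : ℝ} [Fact (1 < α)] (w : W1 Ω α)
    (g : Lp ℝ (ex α) (bdryMeasure Ω)) : Prop :=
  ∃ φ : ℕ → Plane → ℝ, (∀ n, ContDiff ℝ ∞ (φ n)) ∧
    Tendsto (fun n => eLpNorm (φ n - ⇑w.1.fst) (ex α) (volume.restrict Ω)) atTop (𝓝 0) ∧
    Tendsto (fun n => eLpNorm (gradient (φ n) - ⇑w.1.snd) (ex α) (volume.restrict Ω))
      atTop (𝓝 0) ∧
    Tendsto (fun n => eLpNorm (φ n - ⇑g) (ex α) (bdryMeasure Ω)) atTop (𝓝 0)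

theorem tendsto_eLpNorm_add {F : Type*} [NormedAddCommGroup F] {μ : Measure Plane} {p : ℝ≥0∞}
    [hp : Fact (1 ≤ p)] {a b : ℕ → Plane → F} {u v : Lp F p μ}
    (ha : ∀ n, AEStronglyMeasurable (a n) μ) (hb : ∀ n, AEStronglyMeasurable (b n) μ)
    (hu : Tendsto (fun n => eLpNorm (a n - ⇑u) p μ) atTop (𝓝 0))
    (hv : Tendsto (fun n => eLpNorm (b n - ⇑v) p μ) atTop (𝓝 0)) :
    Tendsto (fun n => eLpNorm (a n + b n - ⇑(u + v)) p μ) atTop (𝓝 0) := by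
  refine tendsto_of_tendsto_of_tendsto_of_le_of_le tendsto_const_nhds
    (by simpa using hu.add hv) (fun _ => zero_le) fun n => ?_
  have h : a n + b n - ⇑(u + v) =ᵐ[μ] (a n - ⇑u) + (b n - ⇑v) := by
    filter_upwards [Lp.coeFn_add u v] with x hx
    simp only [Pi.add_apply, Pi.sub_apply, hx]
    abel
  rw [eLpNorm_congr_ae h]
  exact eLpNorm_add_le ((ha n).sub (Lp.aestronglyMeasurable u))
    ((hb n).sub (Lp.aestronglyMeasurable v)) hp.out

theorem tendsto_eLpNorm_smul {F : Type*} [NormedAddCommGroup F] [NormedSpace ℝ F]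
    {μ : Measure Plane} {p : ℝ≥0∞} {a : ℕ → Plane → F} {u : Lp F p μ} (c : ℝ)
    (hu : Tendsto (fun n => eLpNorm (a n - ⇑u) p μ) atTop (𝓝 0)) :
    Tendsto (fun n => eLpNorm (c • a n - ⇑(c • u)) p μ) atTop (𝓝 0) := by
  have h : ∀ n, eLpNorm (c • a n - ⇑(c • u)) p μ = ‖c‖ₑ * eLpNorm (a n - ⇑u) p μ := fun n => by
    rw [← eLpNorm_const_smul]
    refine eLpNorm_congr_ae ?_
    filter_upwards [Lp.coeFn_smul c u] with x hx
    simp only [Pi.smul_apply, Pi.sub_apply, hx, smul_sub]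
  simp only [h]
  simpa using ENNReal.Tendsto.const_mul hu (Or.inr enorm_ne_top)

/-- The space `Y = {y ∈ W^{1,α}(Ω) : y|_{Γ_D} = 0}` of admissible velocity fields, where the
boundary values are taken in the sense of traces. -/
def Y (Ω ΓD : Set Plane) (α : ℝ) [Fact (1 < α)] : Submodule ℝ (W1 Ω α) where
  carrier := {w | ∃ g, HasTrace w g ∧ ∀ᵐ x ∂bdryMeasure Ω, x ∈ ΓD → g x = 0}
  zero_mem' := by
    refine ⟨0, ⟨fun _ => 0, fun _ => contDiff_const, ?_, ?_, ?_⟩, ?_⟩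
    · refine tendsto_const_nhds.congr fun n => ?_
      rw [eq_comm, eLpNorm_congr_ae (g := 0), eLpNorm_zero]
      filter_upwards [Lp.coeFn_zero ℝ (ex α) (volume.restrict Ω)] with x hx
      simpa using hx
    · refine tendsto_const_nhds.congr fun n => ?_
      rw [eq_comm, eLpNorm_congr_ae (g := 0), eLpNorm_zero]
      filter_upwards [Lp.coeFn_zero Plane (ex α) (volume.restrict Ω)] with x hx
      simpa [gradient] using hx
    · refine tendsto_const_nhds.congr fun n => ?_
      rw [eq_comm, eLpNorm_congr_ae (g := 0), eLpNorm_zero]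
      filter_upwards [Lp.coeFn_zero ℝ (ex α) (bdryMeasure Ω)] with x hx
      simpa using hx
    · filter_upwards [Lp.coeFn_zero ℝ (ex α) (bdryMeasure Ω)] with x hx _
      simpa using hx
  add_mem' := by
    rintro v w ⟨g, ⟨φ, hφ, hφ1, hφ2, hφ3⟩, hg⟩ ⟨k, ⟨ψ, hψ, hψ1, hψ2, hψ3⟩, hk⟩
    refine ⟨g + k, ⟨fun n => φ n + ψ n, fun n => (hφ n).add (hψ n), ?_, ?_, ?_⟩, ?_⟩
    · exact tendsto_eLpNorm_add (fun n => (hφ n).continuous.aestronglyMeasurable)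
        (fun n => (hψ n).continuous.aestronglyMeasurable) hφ1 hψ1
    · simp only [gradient_add' (hφ _) (hψ _)]
      exact tendsto_eLpNorm_add (fun n => (continuous_gradient (hφ n)).aestronglyMeasurable)
        (fun n => (continuous_gradient (hψ n)).aestronglyMeasurable) hφ2 hψ2
    · exact tendsto_eLpNorm_add (fun n => (hφ n).continuous.aestronglyMeasurable)
        (fun n => (hψ n).continuous.aestronglyMeasurable) hφ3 hψ3
    · filter_upwards [Lp.coeFn_add g k, hg, hk] with x hx h1 h2 hD
      rw [hx, Pi.add_apply, h1 hD, h2 hD, add_zero]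
  smul_mem' := by
    rintro c v ⟨g, ⟨φ, hφ, hφ1, hφ2, hφ3⟩, hg⟩
    refine ⟨c • g, ⟨fun n => c • φ n, fun n => (hφ n).const_smul c, ?_, ?_, ?_⟩, ?_⟩
    · exact tendsto_eLpNorm_smul c hφ1
    · simp only [gradient_smul' (hφ _)]
      exact tendsto_eLpNorm_smul c hφ2
    · exact tendsto_eLpNorm_smul c hφ3
    · filter_upwards [Lp.coeFn_smul c g, hg] with x hx h1 hD
      rw [hx, Pi.smul_apply, h1 hD, smul_zero]

section Problem

variable {Ω ΓD : Set Plane} {α : ℝ} [Fact (1 < α)]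

/-- The underlying `L^α` function of a velocity field. -/
def velocity (y : Y Ω ΓD α) : LpS Ω (ex α) := y.1.1.fst

/-- The weak gradient `∇y` of a velocity field. -/
def grad (y : Y Ω ΓD α) : LpV Ω (ex α) := y.1.1.snd

/-- The pairing `(f, u)_α` of `L^{α'}(Ω)` and `L^α(Ω)`. -/
def pairS (f : LpS Ω (ex' α)) (u : LpS Ω (ex α)) : ℝ := ∫ x in Ω, f x * u x

/-- The pairing `(τ, q)_α` of `L^{α'}(Ω; ℝ²)` and `L^α(Ω; ℝ²)`. -/
def pairV (τ : LpV Ω (ex' α)) (q : LpV Ω (ex α)) : ℝ := ∫ x in Ω, inner ℝ (τ x) (q x)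

/-- The split objective
`Ĩ(y, q) = κ / α ∫_Ω |q| ^ α dx + τ₀ ∫_Ω |q| dx - (f, y)_α`. -/
def objective (κ τ₀ : ℝ) (f : LpS Ω (ex' α)) (y : Y Ω ΓD α) (q : LpV Ω (ex α)) : ℝ :=
  κ / α * (∫ x in Ω, ‖q x‖ ^ α) + τ₀ * (∫ x in Ω, ‖q x‖) - pairS f (velocity y)

/-- `(y, q)` solves the problem of minimising `Ĩ` subject to `q - ∇y = 0`. -/
def IsSolution (κ τ₀ : ℝ) (f : LpS Ω (ex' α)) (y : Y Ω ΓD α) (q : LpV Ω (ex α)) : Prop :=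
  q - grad y = 0 ∧
    ∀ (z : Y Ω ΓD α) (r : LpV Ω (ex α)), r - grad z = 0 →
      objective κ τ₀ f y q ≤ objective κ τ₀ f z r

/-- The Lagrangian `L(y, q, τ) = Ĩ(y, q) - (τ, q - ∇y)_α`. -/
def lagrangian (κ τ₀ : ℝ) (f : LpS Ω (ex' α)) (y : Y Ω ΓD α) (q : LpV Ω (ex α))
    (τ : LpV Ω (ex' α)) : ℝ :=
  objective κ τ₀ f y q - pairV τ (q - grad y)

/-- The primal function `L_p(y, q) = sup_τ L(y, q, τ)`, with extended real values. -/
def primalFun (κ τ₀ : ℝ) (f : LpS Ω (ex' α)) (y : Y Ω ΓD α) (q : LpV Ω (ex α)) : EReal :=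
  ⨆ τ : LpV Ω (ex' α), (lagrangian κ τ₀ f y q τ : EReal)

variable (ΓD) in
/-- The dual function `L_d(τ) = inf_{(y, q)} L(y, q, τ)`, with extended real values. -/
def dualFun (κ τ₀ : ℝ) (f : LpS Ω (ex' α)) (τ : LpV Ω (ex' α)) : EReal :=
  ⨅ p : Y Ω ΓD α × LpV Ω (ex α), (lagrangian κ τ₀ f p.1 p.2 τ : EReal)

end Problem

/-- The (convex) subdifferential of a real function on a normed space. -/
def subdifferential {X : Type*} [NormedAddCommGroup X] [NormedSpace ℝ X] (φ : X → ℝ) (x : X) :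
    Set (X →L[ℝ] ℝ) :=
  {ξ | ∀ r, φ x + ξ (r - x) ≤ φ r}

end HerschelBulkley

end

open HerschelBulkley

/-! Minimality along the segment from `y` to `z`, where the viscous energy is differentiated and the
yield term is only bounded by convexity, gives a variational inequality
(`IsSolution.variational_inequality`). In terms of the residual k(z) = (f, z) - κ(|q|^(α-2) q, ∇z)
it reads k(z) - k(y) ≤ τ₀‖∇z‖₁ - τ₀‖∇y‖₁. Homogeneity splits it into k(y) = τ₀‖∇y‖₁ and |k(z)| ≤
τ₀‖∇z‖₁.

Hence k factors through the gradient as a functional of L¹-norm at most τ₀ on the space of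
gradients. Hahn–Banach (`exists_continuous_factorization`) extends it to L¹, and L¹–L^∞ duality
(`exists_bounded_density`) represents it by a field g with |g| ≤ τ₀. The multiplier is τ =
κ|q|^(α-2) q + g, the viscous stress plus a yield stress.

With this τ the force balance cancels the velocity from the Lagrangian, and convexity
(`dissipation_sub_pairV_le`) makes `q` a minimiser of what remains. As `q = grad y`, the Lagrangian
at `(y, q)` does not depend on the multiplier. So `(y, q, τ)` is a saddle point, which yields both
the KKT conditions and strong duality. -/

/-! ### Hahn–Banach extension and the power map -/

/-- A linear functional dominated by the norm of a linear map `T` factors through `T` with the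
same bound. -/
theorem exists_continuous_factorization {V F : Type*} [AddCommGroup V] [Module ℝ V]
    [NormedAddCommGroup F] [NormedSpace ℝ F] (T : V →ₗ[ℝ] F) (k : V →ₗ[ℝ] ℝ) {c : ℝ}
    (hc : 0 ≤ c) (h : ∀ z, |k z| ≤ c * ‖T z‖) :
    ∃ M : F →L[ℝ] ℝ, (∀ r, |M r| ≤ c * ‖r‖) ∧ ∀ z, M (T z) = k z := by
  have hker : LinearMap.ker T ≤ LinearMap.ker k := fun z hz => by
    have := h z
    rw [LinearMap.mem_ker.1 hz, norm_zero, mul_zero] at this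
    exact LinearMap.mem_ker.2 (abs_eq_zero.1 (le_antisymm this (abs_nonneg _)))
  -- Since `k` vanishes on the kernel of `T`, it descends to the range; no topology on `V` is
  -- needed.
  let k₀ : LinearMap.range T →ₗ[ℝ] ℝ :=
    ((LinearMap.ker T).liftQ k hker).comp T.quotKerEquivRange.symm.toLinearMap
  have hk₀ : ∀ z, k₀ ⟨T z, z, rfl⟩ = k z := fun z => by
    have : T.quotKerEquivRange.symm ⟨T z, z, rfl⟩ = (LinearMap.ker T).mkQ z :=
      T.quotKerEquivRange_symm_apply_image z _
    simp [k₀, this]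
  have hbound : ∀ v, ‖k₀ v‖ ≤ c * ‖v‖ := by
    rintro ⟨_, z, rfl⟩
    rw [hk₀]
    exact h z
  obtain ⟨M, hM, hn⟩ := exists_extension_norm_eq (LinearMap.range T) (k₀.mkContinuous c hbound)
  refine ⟨M, fun r => ?_, fun z => ?_⟩
  · refine (M.le_opNorm r).trans ?_
    rw [hn]
    gcongr
    exact k₀.mkContinuous_norm_le hc hbound
  · rw [← hk₀ z, hM ⟨T z, z, rfl⟩]
    rfl

/-- At `a = 0` the left side vanishes whatever value `0 ^ (α - 2)` takes, and the right side
vanishes because `α - 1 > 0`. This is the convention |q|^(α-2) q = 0 where q = 0. -/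
theorem norm_rpow_sub_two_smul {E : Type*} [NormedAddCommGroup E] [NormedSpace ℝ E] {α : ℝ}
    (hα : 1 < α) (a : E) : ‖‖a‖ ^ (α - 2) • a‖ = ‖a‖ ^ (α - 1) := by
  rcases eq_or_ne a 0 with rfl | ha
  · simp [Real.zero_rpow (sub_pos.2 hα).ne']
  · rw [norm_smul, Real.norm_of_nonneg (by positivity)]
    nth_rw 2 [← Real.rpow_one ‖a‖]
    rw [← Real.rpow_add (norm_pos_iff.2 ha)]
    ring_nf

/-! ### Integral pairings and the dual of L¹ over a finite measure -/

section Measure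

variable {X E : Type*} [MeasurableSpace X] {μ : Measure X}
  [NormedAddCommGroup E] [InnerProductSpace ℝ E]

theorem MeasureTheory.MemLp.integrable_real_inner {p p' : ℝ≥0∞} [p.HolderConjugate p']
    {u v : X → E} (hu : MemLp u p' μ) (hv : MemLp v p μ) :
    Integrable (fun x => inner ℝ (u x) (v x)) μ := by
  refine (hv.norm.integrable_mul hu.norm).mono' (hu.1.inner hv.1) (ae_of_all _ fun x => ?_)
  simpa [mul_comm] using norm_inner_le_norm (𝕜 := ℝ) (u x) (v x)

/-- The functional on `L^p` given by integration against a vector field in the dual space. -/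
noncomputable def integralInner {p p' : ℝ≥0∞} [p.HolderConjugate p'] {g : X → E}
    (hg : MemLp g p' μ) : Lp E p μ →ₗ[ℝ] ℝ where
  toFun r := ∫ x, inner ℝ (g x) (r x) ∂μ
  map_add' u v := by
    rw [← integral_add (hg.integrable_real_inner (Lp.memLp u))
      (hg.integrable_real_inner (Lp.memLp v))]
    refine integral_congr_ae ?_
    filter_upwards [Lp.coeFn_add u v] with x hx
    rw [hx, Pi.add_apply, inner_add_right]
  map_smul' c u := by
    rw [RingHom.id_apply, ← integral_smul]
    refine integral_congr_ae ?_
    filter_upwards [Lp.coeFn_smul c u] with x hx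
    rw [hx, Pi.smul_apply, real_inner_smul_right, smul_eq_mul]

theorem integralInner_apply {p p' : ℝ≥0∞} [p.HolderConjugate p'] {g : X → E}
    (hg : MemLp g p' μ) (r : Lp E p μ) :
    integralInner hg r = ∫ x, inner ℝ (g x) (r x) ∂μ :=
  rfl

theorem abs_integral_inner_le {g r : X → E} {c : ℝ} (hg : ∀ᵐ x ∂μ, ‖g x‖ ≤ c)
    (hr : Integrable r μ) : |∫ x, inner ℝ (g x) (r x) ∂μ| ≤ c * ∫ x, ‖r x‖ ∂μ := by
  rw [← integral_const_mul, ← Real.norm_eq_abs]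
  refine norm_integral_le_of_norm_le (hr.norm.const_mul c) ?_
  filter_upwards [hg] with x hx
  exact (norm_inner_le_norm (𝕜 := ℝ) (g x) (r x)).trans (by gcongr)

/-- The inclusion of Lebesgue spaces over a finite measure. -/
noncomputable def lpInclusion (E : Type*) [NormedAddCommGroup E] [NormedSpace ℝ E]
    (μ : Measure X) [IsFiniteMeasure μ] {p r : ℝ≥0∞} (h : r ≤ p) :
    Lp E p μ →ₗ[ℝ] Lp E r μ where
  toFun u := ((Lp.memLp u).mono_exponent h).toLp u
  map_add' u v := by
    rw [← MemLp.toLp_add]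
    exact MemLp.toLp_congr _ _ (Lp.coeFn_add u v)
  map_smul' c u := by
    rw [RingHom.id_apply, ← MemLp.toLp_const_smul]
    exact MemLp.toLp_congr _ _ (Lp.coeFn_smul c u)

theorem coeFn_lpInclusion [IsFiniteMeasure μ] {p r : ℝ≥0∞} (h : r ≤ p) (u : Lp E p μ) :
    lpInclusion E μ h u =ᵐ[μ] u :=
  MemLp.coeFn_toLp ((Lp.memLp u).mono_exponent h)

theorem norm_lpInclusion_one [IsFiniteMeasure μ] {p : ℝ≥0∞} (h : 1 ≤ p) (u : Lp E p μ) :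
    ‖lpInclusion E μ h u‖ = ∫ x, ‖u x‖ ∂μ := by
  rw [L1.norm_eq_integral_norm]
  refine integral_congr_ae ?_
  filter_upwards [coeFn_lpInclusion h u] with x hx
  rw [hx]

/-- Hölder's inequality against the constant function 1. -/
theorem exists_norm_lpInclusion_le [IsFiniteMeasure μ] {p r : ℝ≥0∞} (hr : r ≠ 0) (h : r ≤ p) :
    ∃ C : ℝ, 0 ≤ C ∧ ∀ u : Lp E p μ, ‖lpInclusion E μ h u‖ ≤ C * ‖u‖ := by
  refine ⟨(μ Set.univ ^ (1 / r.toReal - 1 / p.toReal)).toReal, ENNReal.toReal_nonneg, fun u => ?_⟩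
  rw [Lp.norm_def, Lp.norm_def, mul_comm, ← ENNReal.toReal_mul,
    eLpNorm_congr_ae (coeFn_lpInclusion h u)]
  have hle := eLpNorm_le_eLpNorm_mul_rpow_measure_univ h (Lp.aestronglyMeasurable u)
  refine ENNReal.toReal_mono (ENNReal.mul_ne_top (Lp.eLpNorm_ne_top u) ?_) hle
  -- For `p = ⊤` the conventions `toReal ⊤ = 0` and `1 / 0 = 0` leave the exponent `1 / r`.
  rcases eq_or_ne p ⊤ with rfl | hp
  · exact ENNReal.rpow_ne_top_of_nonneg (by simp) (measure_ne_top _ _)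
  · refine ENNReal.rpow_ne_top_of_nonneg ?_ (measure_ne_top _ _)
    have hr' : r ≠ ⊤ := ne_top_of_le_ne_top hp h
    exact sub_nonneg.2 (one_div_le_one_div_of_le (ENNReal.toReal_pos hr hr')
      ((ENNReal.toReal_le_toReal hr' hp).2 h))

/-- A bounded functional on `L¹` of a finite measure is given by a bounded density. -/
theorem exists_bounded_density [IsFiniteMeasure μ] [CompleteSpace E] (M : Lp E 1 μ →L[ℝ] ℝ)
    {c : ℝ} (hc : 0 ≤ c) (hM : ∀ r, |M r| ≤ c * ‖r‖) :
    ∃ g : X → E, AEStronglyMeasurable g μ ∧ (∀ᵐ x ∂μ, ‖g x‖ ≤ c) ∧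
      ∀ r : Lp E 1 μ, M r = ∫ x, inner ℝ (g x) (r x) ∂μ := by
  have h12 : (1 : ℝ≥0∞) ≤ 2 := by norm_num
  obtain ⟨C, hC, hCle⟩ := exists_norm_lpInclusion_le (E := E) (μ := μ) one_ne_zero h12
  -- On a finite measure space L² embeds in L¹, so the Riesz theorem in L² supplies the density.
  let M₂ : Lp E 2 μ →L[ℝ] ℝ := M.comp ((lpInclusion E μ h12).mkContinuous C hCle)
  let g : Lp E 2 μ := (InnerProductSpace.toDual ℝ (Lp E 2 μ)).symm M₂
  have hg : ∀ r : Lp E 2 μ, M (lpInclusion E μ h12 r) = ∫ x, inner ℝ (g x) (r x) ∂μ := fun r => by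
    have : inner ℝ g r = M₂ r := InnerProductSpace.toDual_symm_apply
    rw [L2.inner_def] at this
    exact this.symm
  have hgm : StronglyMeasurable (g : X → E) := Lp.stronglyMeasurable g
  have hgi : Integrable (fun x => ‖g x‖) μ := ((Lp.memLp g).integrable h12).norm
  -- Testing with g·1_S, where S = {|g| > c}, gives ∫_S (|g| - c)|g| ≤ 0. The integrand is positive
  -- on S, so S is null.
  have hbound : ∀ᵐ x ∂μ, ‖g x‖ ≤ c := by
    let S : Set X := {x | c < ‖g x‖}
    have hS : MeasurableSet S := measurableSet_lt measurable_const hgm.norm.measurable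
    have hr : MemLp (S.indicator g) 2 μ := (Lp.memLp g).indicator hS
    have h1 := hM (lpInclusion E μ h12 (hr.toLp _))
    rw [hg, norm_lpInclusion_one] at h1
    have e1 : ∫ x, inner ℝ (g x) (hr.toLp _ x) ∂μ = ∫ x in S, ‖g x‖ * ‖g x‖ ∂μ := by
      rw [← integral_indicator hS]
      refine integral_congr_ae ?_
      filter_upwards [hr.coeFn_toLp] with x hx
      rw [hx]
      by_cases hxS : x ∈ S <;> simp [hxS]
      ring
    have e2 : ∫ x, ‖hr.toLp _ x‖ ∂μ = ∫ x in S, ‖g x‖ ∂μ := by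
      rw [← integral_indicator hS]
      refine integral_congr_ae ?_
      filter_upwards [hr.coeFn_toLp] with x hx
      rw [hx, norm_indicator_eq_indicator_norm]
    have hsq : Integrable (fun x => ‖g x‖ * ‖g x‖) μ :=
      ((Lp.memLp g).integrable_real_inner (p := 2) (p' := 2) (Lp.memLp g)).congr
        (ae_of_all _ fun x => real_inner_self_eq_norm_mul_norm _)
    have hd : Integrable (fun x => (‖g x‖ - c) * ‖g x‖) (μ.restrict S) :=
      ((hsq.sub (hgi.const_mul c)).congr (ae_of_all _ fun x => by simp; ring)).restrict
    have h2 : ∫ x in S, (‖g x‖ - c) * ‖g x‖ ∂μ ≤ 0 := by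
      have : ∫ x in S, (‖g x‖ - c) * ‖g x‖ ∂μ
          = ∫ x in S, ‖g x‖ * ‖g x‖ ∂μ - c * ∫ x in S, ‖g x‖ ∂μ := by
        rw [← integral_const_mul, ← integral_sub hsq.restrict (hgi.const_mul c).restrict]
        exact integral_congr_ae (ae_of_all _ fun x => by simp; ring)
      rw [this, ← e1, ← e2]
      linarith [le_abs_self (∫ x, inner ℝ (g x) (hr.toLp _ x) ∂μ)]
    have hnn : 0 ≤ᵐ[μ.restrict S] fun x => (‖g x‖ - c) * ‖g x‖ := by
      filter_upwards [ae_restrict_mem hS] with x hx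
      exact mul_nonneg (sub_nonneg.2 (le_of_lt hx)) (norm_nonneg _)
    have h3 := (integral_eq_zero_iff_of_nonneg_ae hnn hd).1
      (le_antisymm h2 (integral_nonneg_of_ae hnn))
    filter_upwards [(ae_restrict_iff' hS).1 h3] with x hx
    by_contra! hcx
    exact (mul_pos (sub_pos.2 hcx) (hc.trans_lt hcx)).ne' (hx hcx)
  have hgtop : MemLp g ⊤ μ := memLp_top_of_bound hgm.aestronglyMeasurable c hbound
  let N : Lp E 1 μ →ₗ[ℝ] ℝ := integralInner hgtop
  have hN : Continuous N := (N.mkContinuous c fun r => by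
    rw [L1.norm_eq_integral_norm]
    exact abs_integral_inner_le hbound (L1.integrable_coeFn r)).continuous
  refine ⟨g, hgm.aestronglyMeasurable, hbound, fun r => ?_⟩
  -- Both functionals are continuous on L¹ and agree on indicators of sets of finite measure, which
  -- lie in L².
  refine Lp.induction ENNReal.one_ne_top (motive := fun r => M r = N r) ?_ ?_ ?_ r
  · intro e s hs hμs
    have hr : lpInclusion E μ h12 (indicatorConstLp 2 hs hμs.ne e)
        = indicatorConstLp 1 hs hμs.ne e :=
      Lp.ext ((coeFn_lpInclusion _ _).trans
        (indicatorConstLp_coeFn.trans indicatorConstLp_coeFn.symm))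
    rw [Lp.simpleFunc.coe_indicatorConst, ← hr, hg, integralInner_apply]
    refine integral_congr_ae ?_
    filter_upwards [coeFn_lpInclusion h12 (indicatorConstLp 2 hs hμs.ne e)] with x hx
    rw [hx]
  · intro u v hu hv _ h1 h2
    rw [map_add, map_add, h1, h2]
  · exact isClosed_eq M.continuous hN

/-! ### Convexity and differentiation of the power energy -/

/-- The subgradient inequality for `‖·‖ ^ α / α`. -/
theorem rpow_norm_add_inner_le {α : ℝ} (hα : 1 < α) (a b : E) :
    ‖a‖ ^ α / α + inner ℝ (‖a‖ ^ (α - 2) • a) (b - a) ≤ ‖b‖ ^ α / α := by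
  have hconj := Real.HolderConjugate.conjExponent hα
  have h0 : 0 < α := by linarith
  have hself : inner ℝ (‖a‖ ^ (α - 2) • a) a = ‖a‖ ^ α := by
    rcases eq_or_ne a 0 with rfl | ha
    · simp [Real.zero_rpow h0.ne']
    · rw [real_inner_smul_left, real_inner_self_eq_norm_sq, ← Real.rpow_natCast ‖a‖ 2,
        ← Real.rpow_add (norm_pos_iff.2 ha)]
      norm_num
  have hnorm : ‖‖a‖ ^ (α - 2) • a‖ = ‖a‖ ^ (α - 1) := norm_rpow_sub_two_smul hα a
  have hle : inner ℝ (‖a‖ ^ (α - 2) • a) b ≤ ‖a‖ ^ (α - 1) * ‖b‖ := by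
    rw [← hnorm]
    exact real_inner_le_norm _ _
  -- Young's inequality for |b| and |a|^(α-1); the dual power of the latter is |a|^α.
  have hY := Real.young_inequality_of_nonneg (norm_nonneg b)
    (Real.rpow_nonneg (norm_nonneg a) (α - 1)) hconj
  rw [← Real.rpow_mul (norm_nonneg a), hconj.sub_one_mul_conj] at hY
  rw [inner_sub_right, hself]
  have : ‖a‖ ^ α / α + ‖a‖ ^ α / α.conjExponent = ‖a‖ ^ α := by
    have := hconj.inv_add_inv_eq_one
    rw [div_eq_mul_inv, div_eq_mul_inv, ← mul_add, this, mul_one]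
  linarith [mul_comm ‖b‖ (‖a‖ ^ (α - 1))]

/-- The field has norm |q|^(α-1), and α / (α - 1) is the dual exponent. -/
theorem MeasureTheory.MemLp.norm_rpow_sub_two_smul {α : ℝ} (hα : 1 < α) {q : X → E}
    (hq : MemLp q (ENNReal.ofReal α) μ) :
    MemLp (fun x => ‖q x‖ ^ (α - 2) • q x) (ENNReal.ofReal α.conjExponent) μ := by
  have h := hq.norm_rpow_div (ENNReal.ofReal (α - 1))
  rw [← ENNReal.ofReal_div_of_pos (by linarith), ENNReal.toReal_ofReal (by linarith)] at h
  refine h.mono ?_ (ae_of_all _ fun x => ?_)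
  · exact ((hq.1.norm.aemeasurable.pow_const _).aestronglyMeasurable).smul hq.1
  · rw [_root_.norm_rpow_sub_two_smul hα, Real.norm_of_nonneg (by positivity)]

/-- Differentiation of the energy `∫ ‖q‖ ^ α` in a direction `h`. -/
theorem hasDerivAt_integral_norm_rpow {α : ℝ} (hα : 1 < α) {q h : X → E}
    (hq : MemLp q (ENNReal.ofReal α) μ) (hh : MemLp h (ENNReal.ofReal α) μ) :
    HasDerivAt (fun t : ℝ => ∫ x, ‖q x + t • h x‖ ^ α ∂μ)
      (α * ∫ x, inner ℝ (‖q x‖ ^ (α - 2) • q x) (h x) ∂μ) 0 := by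
  have h0 : 0 < α := by linarith
  have hint : ∀ {u : X → E}, MemLp u (ENNReal.ofReal α) μ → Integrable (fun x => ‖u x‖ ^ α) μ :=
    fun hu => by
      have := hu.integrable_norm_rpow (by simpa using h0) ENNReal.ofReal_ne_top
      rwa [ENNReal.toReal_ofReal h0.le] at this
  -- Dominating function for |t| ≤ 1: the derivative is at most α|q + th|^(α-1)|h|, and both |q +
  -- th| and |h| are at most |q| + |h|.
  have hb : Integrable (fun x => α * (‖q x‖ + ‖h x‖) ^ α) μ := by
    have := (hq.norm.add hh.norm).integrable_norm_rpow (by simpa using h0) ENNReal.ofReal_ne_top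
    rw [ENNReal.toReal_ofReal h0.le] at this
    refine (this.const_mul α).congr (ae_of_all _ fun x => ?_)
    simp [abs_of_nonneg (add_nonneg (norm_nonneg (q x)) (norm_nonneg (h x)))]
  have key := hasDerivAt_integral_of_dominated_loc_of_deriv_le (μ := μ)
    (F := fun (t : ℝ) x => ‖q x + t • h x‖ ^ α)
    (F' := fun t x => α * inner ℝ (‖q x + t • h x‖ ^ (α - 2) • (q x + t • h x)) (h x))
    (x₀ := 0) (Metric.ball_mem_nhds (0 : ℝ) one_pos)
    (Eventually.of_forall fun t => (hint (hq.add (hh.const_smul t))).1)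
    (by simpa using hint hq) ?_ ?_ hb ?_
  · simpa [integral_const_mul] using key.2
  · simpa using ((hq.norm_rpow_sub_two_smul hα).1.inner hh.1).const_mul α
  · refine ae_of_all _ fun x t ht => ?_
    have ht1 : |t| ≤ 1 := by simpa using (Metric.mem_ball.1 ht).le
    have hn : ‖q x + t • h x‖ ≤ ‖q x‖ + ‖h x‖ := by
      refine (norm_add_le _ _).trans ?_
      rw [norm_smul, Real.norm_eq_abs]
      nlinarith [norm_nonneg (h x)]
    rw [norm_mul, Real.norm_of_nonneg h0.le]
    refine mul_le_mul_of_nonneg_left ?_ h0.le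
    refine (norm_inner_le_norm (𝕜 := ℝ) _ _).trans ?_
    rw [_root_.norm_rpow_sub_two_smul hα]
    have hs : 0 ≤ ‖q x‖ + ‖h x‖ := by positivity
    calc ‖q x + t • h x‖ ^ (α - 1) * ‖h x‖
        ≤ (‖q x‖ + ‖h x‖) ^ (α - 1) * (‖q x‖ + ‖h x‖) ^ (1 : ℝ) := by
          rw [Real.rpow_one]
          gcongr
          linarith [norm_nonneg (q x)]
      _ = (‖q x‖ + ‖h x‖) ^ α := by
          rw [← Real.rpow_add' hs (by simpa using h0.ne'), sub_add_cancel]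
  · refine ae_of_all _ fun x t _ => ?_
    have hl : HasDerivAt (fun t : ℝ => q x + t • h x) (h x) t := by
      simpa using ((hasDerivAt_id t).smul_const (h x)).const_add (q x)
    have := (hasFDerivAt_norm_rpow (q x + t • h x) hα).comp_hasDerivAt t hl
    refine this.congr_deriv ?_
    rw [real_inner_smul_left, ← mul_assoc]
    rfl

/-- The first-order condition for the energy `κ / α * ∫ ‖q‖ ^ α` perturbed by a linear term. -/
theorem energy_first_order {α κ D : ℝ} (hα : 1 < α) {q h : X → E}
    (hq : MemLp q (ENNReal.ofReal α) μ) (hh : MemLp h (ENNReal.ofReal α) μ)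
    (hmin : ∀ t ∈ Set.Ioo (0 : ℝ) 1, κ / α * ∫ x, ‖q x‖ ^ α ∂μ
      ≤ κ / α * ∫ x, ‖q x + t • h x‖ ^ α ∂μ + t * D) :
    0 ≤ κ * ∫ x, inner ℝ (‖q x‖ ^ (α - 2) • q x) (h x) ∂μ + D := by
  have h0 : α ≠ 0 := by linarith
  have hd := ((hasDerivAt_integral_norm_rpow hα hq hh).const_mul (κ / α)).add
    ((hasDerivAt_id (0 : ℝ)).mul_const D)
  have hlim := hd.tendsto_slope_zero_right
  have hval : κ / α * (α * ∫ x, inner ℝ (‖q x‖ ^ (α - 2) • q x) (h x) ∂μ) + 1 * D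
      = κ * ∫ x, inner ℝ (‖q x‖ ^ (α - 2) • q x) (h x) ∂μ + D := by
    rw [← mul_assoc, div_mul_cancel₀ _ h0, one_mul]
  rw [hval] at hlim
  refine ge_of_tendsto hlim ?_
  filter_upwards [Ioo_mem_nhdsGT (one_pos : (0 : ℝ) < 1)] with t ht
  refine smul_nonneg (inv_nonneg.2 ht.1.le) ?_
  simpa using hmin t ht

end Measure
-- The variational inequality and the multiplier
section Problem

variable {Ω ΓD : Set Plane} {α : ℝ} [Fact (1 < α)]

/-- The velocity as a linear map. -/
noncomputable def velocityₗ (Ω ΓD : Set Plane) (α : ℝ) [Fact (1 < α)] :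
    Y Ω ΓD α →ₗ[ℝ] LpS Ω (ex α) where
  toFun := velocity
  map_add' _ _ := rfl
  map_smul' _ _ := rfl

/-- The weak gradient as a linear map. -/
noncomputable def gradₗ (Ω ΓD : Set Plane) (α : ℝ) [Fact (1 < α)] :
    Y Ω ΓD α →ₗ[ℝ] LpV Ω (ex α) where
  toFun := grad
  map_add' _ _ := rfl
  map_smul' _ _ := rfl

/-- The work of the force `f` as a linear functional of the velocity field. -/
noncomputable def forceₗ (ΓD : Set Plane) (f : LpS Ω (ex' α)) : Y Ω ΓD α →ₗ[ℝ] ℝ :=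
  (integralInner (p := ex α) (Lp.memLp f)).comp (velocityₗ Ω ΓD α)

theorem forceₗ_apply (f : LpS Ω (ex' α)) (z : Y Ω ΓD α) :
    forceₗ ΓD f z = pairS f (velocity z) :=
  integral_congr_ae (ae_of_all _ fun _ => mul_comm _ _)

theorem pairV_sub (τ : LpV Ω (ex' α)) (u v : LpV Ω (ex α)) :
    pairV τ (u - v) = pairV τ u - pairV τ v :=
  map_sub (integralInner (p := ex α) (Lp.memLp τ)) u v

/-- The variational inequality of the constrained minimisation problem. -/
theorem HerschelBulkley.IsSolution.variational_inequality
    [IsFiniteMeasure ((volume : Measure Plane).restrict Ω)]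
    {κ τ₀ : ℝ} (hτ₀ : 0 ≤ τ₀) {f : LpS Ω (ex' α)} {y : Y Ω ΓD α} {q : LpV Ω (ex α)}
    (hsol : IsSolution κ τ₀ f y q) (z : Y Ω ΓD α) :
    pairS f (velocity z) - pairS f (velocity y)
      ≤ κ * (∫ x in Ω, inner ℝ (‖q x‖ ^ (α - 2) • q x) ((grad z - q) x))
        + τ₀ * (∫ x in Ω, ‖grad z x‖) - τ₀ * (∫ x in Ω, ‖q x‖) := by
  have hα : 1 < α := Fact.out
  have hqy : q = grad y := sub_eq_zero.1 hsol.1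
  have hint : ∀ u : LpV Ω (ex α), Integrable (fun x => ‖u x‖) (volume.restrict Ω) := fun u =>
    ((Lp.memLp u).integrable Fact.out).norm
  -- `D` bounds the increment of the yield and force terms per unit `t`: exact for the force, an
  -- upper bound by convexity for the yield term. The nonsmooth term is thus never differentiated.
  have key := energy_first_order (κ := κ) (D := τ₀ * (∫ x in Ω, ‖grad z x‖)
      - τ₀ * (∫ x in Ω, ‖q x‖) - (pairS f (velocity z) - pairS f (velocity y))) hα
    (Lp.memLp q) (Lp.memLp (grad z - q)) fun t ht => ?_
  · linarith
  have hg : grad (y + t • (z - y)) = q + t • (grad z - q) := by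
    rw [hqy]
    exact (map_add (gradₗ Ω ΓD α) _ _).trans (by rw [map_smul, map_sub]; rfl)
  have hae : ∀ᵐ x ∂volume.restrict Ω,
      grad (y + t • (z - y)) x = q x + t • (grad z - q) x := by
    rw [hg]
    filter_upwards [Lp.coeFn_add q (t • (grad z - q)), Lp.coeFn_smul t (grad z - q)] with x h1 h2
    rw [h1, Pi.add_apply, h2, Pi.smul_apply]
  have h := hsol.2 _ _ (sub_self (grad (y + t • (z - y))))
  have e1 : ∫ x in Ω, ‖grad (y + t • (z - y)) x‖ ^ α
      = ∫ x in Ω, ‖q x + t • (grad z - q) x‖ ^ α :=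
    integral_congr_ae (by filter_upwards [hae] with x hx; rw [hx])
  have e2 : ∫ x in Ω, ‖grad (y + t • (z - y)) x‖
      ≤ (1 - t) * (∫ x in Ω, ‖q x‖) + t * ∫ x in Ω, ‖grad z x‖ := by
    rw [← integral_const_mul, ← integral_const_mul,
      ← integral_add ((hint q).const_mul _) ((hint (grad z)).const_mul _)]
    refine integral_mono_ae (hint _) (((hint q).const_mul _).add ((hint (grad z)).const_mul _)) ?_
    filter_upwards [hae, Lp.coeFn_sub (grad z) q] with x hx hx'
    have : grad (y + t • (z - y)) x = (1 - t) • q x + t • grad z x := by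
      rw [hx, hx', Pi.sub_apply]
      module
    rw [this]
    refine (norm_add_le _ _).trans_eq ?_
    rw [norm_smul, norm_smul, Real.norm_of_nonneg ht.1.le,
      Real.norm_of_nonneg (sub_nonneg.2 ht.2.le)]
  have e3 : pairS f (velocity (y + t • (z - y)))
      = pairS f (velocity y) + t * (pairS f (velocity z) - pairS f (velocity y)) := by
    simp only [← forceₗ_apply, map_add, map_smul, map_sub, smul_eq_mul]
  unfold objective at h
  rw [e1, e3] at h
  have := mul_le_mul_of_nonneg_left e2 hτ₀
  linarith

/-- Existence of a Lagrange multiplier, decomposed into the viscous stress and a bounded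
yield stress. -/
theorem HerschelBulkley.IsSolution.exists_multiplier
    [IsFiniteMeasure ((volume : Measure Plane).restrict Ω)]
    {κ τ₀ : ℝ} (hτ₀ : 0 ≤ τ₀) {f : LpS Ω (ex' α)} {y : Y Ω ΓD α} {q : LpV Ω (ex α)}
    (hsol : IsSolution κ τ₀ f y q) :
    ∃ τ : LpV Ω (ex' α), (∀ z : Y Ω ΓD α, pairV τ (grad z) = pairS f (velocity z)) ∧
      ∀ r : LpV Ω (ex α),
        0 ≤ (∫ x in Ω, inner ℝ (κ • ‖q x‖ ^ (α - 2) • q x - τ x) (r x - q x))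
          + τ₀ * (∫ x in Ω, ‖r x‖) - τ₀ * (∫ x in Ω, ‖q x‖) := by
  have hα : 1 < α := Fact.out
  have h1 : (1 : ℝ≥0∞) ≤ ex α := Fact.out
  have hqy : grad y = q := (sub_eq_zero.1 hsol.1).symm
  have hA : MemLp (fun x => κ • ‖q x‖ ^ (α - 2) • q x) (ex' α) (volume.restrict Ω) :=
    ((Lp.memLp q).norm_rpow_sub_two_smul hα).const_smul κ
  let A : LpV Ω (ex α) →ₗ[ℝ] ℝ := integralInner hA
  let T : Y Ω ΓD α →ₗ[ℝ] Lp Plane 1 (volume.restrict Ω) :=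
    (lpInclusion Plane (volume.restrict Ω) h1).comp (gradₗ Ω ΓD α)
  let k : Y Ω ΓD α →ₗ[ℝ] ℝ := forceₗ ΓD f - A.comp (gradₗ Ω ΓD α)
  have hk : ∀ z, k z = pairS f (velocity z) - A (grad z) := fun z => by
    rw [← forceₗ_apply]
    rfl
  have hT : ∀ z, ‖T z‖ = ∫ x in Ω, ‖grad z x‖ := fun z => norm_lpInclusion_one h1 (grad z)
  have hvar : ∀ z, k z - k y ≤ τ₀ * ‖T z‖ - τ₀ * ‖T y‖ := fun z => by
    have h := hsol.variational_inequality hτ₀ z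
    have hAz : κ * (∫ x in Ω, inner ℝ (‖q x‖ ^ (α - 2) • q x) ((grad z - q) x))
        = A (grad z) - A q := by
      rw [← map_sub, ← integral_const_mul]
      exact integral_congr_ae (ae_of_all _ fun x => (real_inner_smul_left _ _ _).symm)
    rw [hAz] at h
    rw [hk, hk, hT, hT, hqy]
    linarith
  -- The competitors 0 and 2y give the two opposite inequalities.
  have hky : k y = τ₀ * ‖T y‖ := by
    have h0 := hvar 0
    have h2 := hvar ((2 : ℝ) • y)
    simp only [map_zero, norm_zero, mul_zero, map_smul, norm_smul, smul_eq_mul,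
      Real.norm_ofNat] at h0 h2
    linarith
  have hle : ∀ z, k z ≤ τ₀ * ‖T z‖ := fun z => by linarith [hvar z]
  obtain ⟨M, hM, hMT⟩ := exists_continuous_factorization T k hτ₀ fun z =>
    abs_le'.2 ⟨hle z, by simpa using hle (-z)⟩
  obtain ⟨g, hgm, hgb, hg⟩ := exists_bounded_density M hτ₀ hM
  have hgL : MemLp g (ex' α) (volume.restrict Ω) := MemLp.of_bound hgm τ₀ hgb
  -- Viscous stress plus yield stress; the bounded field `g` lies in the dual space because Ω has
  -- finite measure.
  let τ : LpV Ω (ex' α) := (hA.add hgL).toLp _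
  have hτ : ∀ᵐ x ∂volume.restrict Ω, τ x = κ • ‖q x‖ ^ (α - 2) • q x + g x :=
    (hA.add hgL).coeFn_toLp
  let G : LpV Ω (ex α) →ₗ[ℝ] ℝ := integralInner hgL
  have hGT : ∀ z, G (grad z) = k z := fun z => by
    rw [← hMT, hg]
    refine integral_congr_ae ?_
    filter_upwards [coeFn_lpInclusion h1 (grad z)] with x hx
    exact congrArg _ hx.symm
  have hpair : ∀ r, pairV τ r = A r + G r := fun r => by
    refine Eq.trans ?_ (integral_add (hA.integrable_real_inner (Lp.memLp r))
      (hgL.integrable_real_inner (Lp.memLp r)))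
    refine integral_congr_ae ?_
    filter_upwards [hτ] with x hx
    rw [hx, inner_add_left]
  refine ⟨τ, fun z => ?_, fun r => ?_⟩
  · rw [hpair, hGT, hk]
    ring
  -- The viscous part cancels. What remains is `G r ≤ τ₀ * ∫ ‖r‖`, with equality at `r = q`: `g` is
  -- a subgradient of the yield term there.
  · have e : ∫ x in Ω, inner ℝ (κ • ‖q x‖ ^ (α - 2) • q x - τ x) (r x - q x) = G q - G r := by
      rw [← map_sub]
      refine integral_congr_ae ?_
      filter_upwards [hτ, Lp.coeFn_sub q r] with x hx hx'
      rw [hx, hx', Pi.sub_apply, sub_add_cancel_left, inner_neg_left, ← inner_neg_right, neg_sub]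
    have hGr : G r ≤ τ₀ * ∫ x in Ω, ‖r x‖ :=
      (le_abs_self _).trans (abs_integral_inner_le hgb ((Lp.memLp r).integrable h1))
    have hGq : G q = τ₀ * ∫ x in Ω, ‖q x‖ := by
      have := hT y
      rw [hqy] at this
      rw [← this, ← hky, ← hGT, hqy]
    rw [e, hGq]
    linarith

/-- The variational inequality for the multiplier yields minimality of the dissipation minus
the work of the multiplier. -/
theorem dissipation_sub_pairV_le {κ τ₀ : ℝ} (hκ : 0 ≤ κ) {q : LpV Ω (ex α)} {τ : LpV Ω (ex' α)} (r : LpV Ω (ex α))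
    (h : 0 ≤ (∫ x in Ω, inner ℝ (κ • ‖q x‖ ^ (α - 2) • q x - τ x) (r x - q x))
      + τ₀ * (∫ x in Ω, ‖r x‖) - τ₀ * (∫ x in Ω, ‖q x‖)) :
    κ / α * (∫ x in Ω, ‖q x‖ ^ α) + τ₀ * (∫ x in Ω, ‖q x‖) - pairV τ q
      ≤ κ / α * (∫ x in Ω, ‖r x‖ ^ α) + τ₀ * (∫ x in Ω, ‖r x‖) - pairV τ r := by
  have hα : 1 < α := Fact.out
  have h0 : 0 < α := by linarith
  have hint : ∀ u : LpV Ω (ex α), Integrable (fun x => ‖u x‖ ^ α) (volume.restrict Ω) :=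
    fun u => by
      have := (Lp.memLp u).integrable_norm_rpow (by simpa using h0) ENNReal.ofReal_ne_top
      rwa [ENNReal.toReal_ofReal h0.le] at this
  have hd : MemLp (fun x => r x - q x) (ex α) (volume.restrict Ω) := (Lp.memLp r).sub (Lp.memLp q)
  have hA := ((Lp.memLp q).norm_rpow_sub_two_smul hα).const_smul κ
  have e : ∫ x in Ω, inner ℝ (κ • ‖q x‖ ^ (α - 2) • q x - τ x) (r x - q x)
      = (∫ x in Ω, inner ℝ (κ • ‖q x‖ ^ (α - 2) • q x) (r x - q x))
        - (pairV τ r - pairV τ q) := by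
    have : pairV τ r - pairV τ q = ∫ x in Ω, inner ℝ (τ x) (r x - q x) := by
      rw [← pairV_sub]
      refine integral_congr_ae ?_
      filter_upwards [Lp.coeFn_sub r q] with x hx
      rw [hx, Pi.sub_apply]
    rw [this]
    refine Eq.trans ?_ (integral_sub (hA.integrable_real_inner hd)
      ((Lp.memLp τ).integrable_real_inner hd))
    exact integral_congr_ae (ae_of_all _ fun x => inner_sub_left _ _ _)
  -- The pointwise subgradient inequality, scaled by κ ≥ 0 and integrated.
  have hconv : κ / α * (∫ x in Ω, ‖q x‖ ^ α)
      + (∫ x in Ω, inner ℝ (κ • ‖q x‖ ^ (α - 2) • q x) (r x - q x))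
      ≤ κ / α * (∫ x in Ω, ‖r x‖ ^ α) := by
    rw [← integral_const_mul, ← integral_const_mul]
    refine (integral_add ((hint q).const_mul _) (hA.integrable_real_inner hd)).symm.trans_le ?_
    refine integral_mono (((hint q).const_mul _).add (hA.integrable_real_inner hd))
      ((hint r).const_mul _) fun x => ?_
    have := mul_le_mul_of_nonneg_left (rpow_norm_add_inner_le hα (q x) (r x)) hκ
    simp only [Pi.smul_apply, real_inner_smul_left] at this ⊢
    calc _ = _ := by ring
      _ ≤ _ := this
      _ = _ := by ring
  rw [e] at h
  linarith

end Problem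

/-! ### KKT conditions and strong duality -/

theorem mainTheorem2
    (Ω ΓD ΓN : Set Plane) (hΩ : IsLipschitzDomain Ω)
    (hΓ : ΓD ∪ ΓN = frontier Ω) (hdisj : Disjoint ΓD ΓN)
    (hΓD : NullMeasurableSet ΓD (bdryMeasure Ω)) (hΓN : NullMeasurableSet ΓN (bdryMeasure Ω))
    (hpos : 0 < bdryMeasure Ω ΓD)
    (α κ τ₀ : ℝ) [Fact (1 < α)] (hκ : 0 < κ) (hτ₀ : 0 ≤ τ₀)
    (f : LpS Ω (ex' α))
    (y : Y Ω ΓD α) (q : LpV Ω (ex α)) (hsol : IsSolution κ τ₀ f y q) :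
    ∃ τ : LpV Ω (ex' α),
      -- the KKT conditions in terms of the Lagrangian
      (HasFDerivAt (fun z : Y Ω ΓD α => lagrangian κ τ₀ f z q τ) (0 : Y Ω ΓD α →L[ℝ] ℝ) y ∧
        0 ∈ subdifferential (fun r : LpV Ω (ex α) => lagrangian κ τ₀ f y r τ) q ∧
        HasFDerivAt (fun σ : LpV Ω (ex' α) => lagrangian κ τ₀ f y q σ)
          (0 : LpV Ω (ex' α) →L[ℝ] ℝ) τ) ∧
      -- the KKT conditions written out
      ((∀ z : Y Ω ΓD α, pairV τ (grad z) = pairS f (velocity z)) ∧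
        (∀ r : LpV Ω (ex α),
          0 ≤ (∫ x in Ω, inner ℝ (κ • ‖q x‖ ^ (α - 2) • q x - τ x) (r x - q x))
            + τ₀ * (∫ x in Ω, ‖r x‖) - τ₀ * (∫ x in Ω, ‖q x‖)) ∧
        ∀ᵐ x ∂volume.restrict Ω, q x = grad y x) ∧
      -- strong duality: `(y, q)` minimises the primal function, `τ` maximises the dual function,
      -- and the two optimal values agree
      ((∀ (z : Y Ω ΓD α) (r : LpV Ω (ex α)), primalFun κ τ₀ f y q ≤ primalFun κ τ₀ f z r) ∧
        (∀ σ : LpV Ω (ex' α), dualFun ΓD κ τ₀ f σ ≤ dualFun ΓD κ τ₀ f τ) ∧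
        primalFun κ τ₀ f y q = dualFun ΓD κ τ₀ f τ) := by
  have : IsFiniteMeasure ((volume : Measure Plane).restrict Ω) :=
    ⟨by simpa using hΩ.isBounded.measure_lt_top⟩
  obtain ⟨τ, hτY, hτq⟩ := hsol.exists_multiplier hτ₀
  have hqy : q = grad y := sub_eq_zero.1 hsol.1
  -- By the force balance (τ, ∇z) cancels (f, z), so the Lagrangian at `τ` is constant in the
  -- velocity.
  have hlag : ∀ z r, lagrangian κ τ₀ f z r τ
      = κ / α * (∫ x in Ω, ‖r x‖ ^ α) + τ₀ * (∫ x in Ω, ‖r x‖) - pairV τ r := fun z r => by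
    rw [lagrangian, objective, pairV_sub, hτY]
    ring
  have hfeas : ∀ σ, lagrangian κ τ₀ f y q σ = objective κ τ₀ f y q := fun σ => by
    rw [lagrangian, pairV_sub, ← hqy, sub_self, sub_zero]
  have hmin : ∀ z r, lagrangian κ τ₀ f y q τ ≤ lagrangian κ τ₀ f z r τ := fun z r => by
    rw [hlag, hlag]
    exact dissipation_sub_pairV_le hκ.le r (hτq r)
  have hprimal : primalFun κ τ₀ f y q = (objective κ τ₀ f y q : EReal) := by
    simp only [primalFun, hfeas, ciSup_const]
  have hdual : dualFun ΓD κ τ₀ f τ = (objective κ τ₀ f y q : EReal) := by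
    refine le_antisymm ((iInf_le _ (y, q)).trans_eq ?_) (le_iInf fun p => ?_)
    · simp only [hfeas]
    · rw [← hfeas τ]
      exact EReal.coe_le_coe_iff.2 (hmin p.1 p.2)
  refine ⟨τ, ⟨?_, fun r => ?_, ?_⟩, ⟨hτY, hτq, ?_⟩, fun z r => ?_, fun σ => ?_, ?_⟩
  · simp only [hlag]
    exact hasFDerivAt_const _ _
  · simpa using hmin y r
  · simp only [hfeas]
    exact hasFDerivAt_const _ _
  · exact ae_of_all _ fun x => by rw [← hqy]
  -- Weak duality: the value at the saddle point is at most L(z, r, τ), hence at most the supremum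
  -- over multipliers.
  · rw [hprimal, ← hfeas τ]
    exact (EReal.coe_le_coe_iff.2 (hmin z r)).trans
      (le_iSup (fun σ => (lagrangian κ τ₀ f z r σ : EReal)) τ)
  · rw [hdual, ← hfeas σ]
    exact iInf_le (fun p : Y Ω ΓD α × LpV Ω (ex α) => (lagrangian κ τ₀ f p.1 p.2 σ : EReal)) (y, q)
  · rw [hprimal, hdual]
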